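/- Let $d\ge 3$ and $n_1,\dots,n_d\ge 2$, let $N=n_1\cdots n_d-1$, and let $X=\mathrm{Seg}(\mathbb P^{n_1-1}\times\cdots\times\mathbb P^{n_d-1})\subset\mathbb P^N=\mathbb P(\mathbb C^{n_1}\otimes\cdots\otimes\mathbb C^{n_d})$ be the Segre variety of rank one tensors. For $Z\subseteq\mathbb P^N$ write $Z_{\mathbb R}=Z\cap\mathbb P^N_{\mathbb R}$. All closures and interiors are in the Euclidean topology. Let $\sigma(X)\subset\mathbb P^N$ be the secant variety, i.e. the closure of the set of points lying on a line spanned by two distinct points of $X$. Let $\rho(X)\subset\mathbb P^N_{\mathbb R}$ be the real rank two locus, i.e. the closure of the set of points lying on a line spanned by two distinct points of $X_{\mathbb R}$. Let $\partial(\rho(X))$ be $\rho(X)$ minus its relative interior, i.e. its interior as a subset of the topological space $\sigma(X)_{\mathbb R}$. A $2\times2\times2$ sub-tensor of a tensor $T$ is obtained by fixing $d-3$ of the indices and letting each of the remaining three take one of two different values; its hyperdeterminant (Cayley's) is called a $2\times2\times2$ sub-hyperdeterminant of $T$. Let $\mathrm{Hyp}\subset\mathbb P^N$ be the variety of tensors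 all of whose $2\times2\times2$ sub-hyperdeterminants are zero. Then $$\partial(\rho(X))\ \subseteq\ \mathrm{Hyp}\cap\rho(X).$$ If $d=3$, this containment is an equality. If $d\ge4$, it is strict; more precisely, $\mathrm{Hyp}$ contains a point of the relative interior of $\rho(X)$, namely the tensor $$\bigl(e_1\otimes e_1\otimes e_1\otimes e_1+e_2\otimes e_2\otimes e_2\otimes e_2\bigr)\otimes e_1\otimes\cdots\otimes e_1,$$ where there are $d-4$ trailing factors $e_1$ and $e_1,e_2$ are the first two standard basis vectors of each $\mathbb R^{n_j}$. -/

import Mathlib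

open scoped LinearAlgebra.Projectivization

noncomputable section

/-- The Euclidean topology on a projective space: the quotient topology
from the nonzero vectors. -/
instance projTopology (K V : Type*) [DivisionRing K] [AddCommGroup V] [Module K V]
    [TopologicalSpace V] : TopologicalSpace (ℙ K V) :=
  TopologicalSpace.coinduced (Projectivization.mk' K (V := V)) inferInstance

section General

variable {ι : Type*}

/-- Coordinatewise inclusion of real vectors into complex vectors. -/
def complexifyVec (ι : Type*) : (ι → ℝ) →ₛₗ[algebraMap ℝ ℂ] (ι → ℂ) where
  toFun v i := (v i : ℂ)
  map_add' v w := by ext i; simp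
  map_smul' c v := by ext i; simp

theorem complexifyVec_injective (ι : Type*) : Function.Injective (complexifyVec ι) := by
  intro v w h
  ext i
  exact Complex.ofReal_injective (congrFun h i)

/-- The inclusion of real projective space into complex projective space. -/
def complexify (ι : Type*) : ℙ ℝ (ι → ℝ) → ℙ ℂ (ι → ℂ) :=
  Projectivization.map (complexifyVec ι) (complexifyVec_injective ι)

/-- The set of real points of a subset of complex projective space. -/
def realPoints (Z : Set (ℙ ℂ (ι → ℂ))) : Set (ℙ ℝ (ι → ℝ)) :=
  complexify ι ⁻¹' Z

/-- The points lying on a line spanned by two distinct points of `S`. -/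
def secantPoints {K V : Type*} [DivisionRing K] [AddCommGroup V] [Module K V]
    (S : Set (ℙ K V)) : Set (ℙ K V) :=
  {p | ∃ x ∈ S, ∃ y ∈ S, x ≠ y ∧ p.submodule ≤ x.submodule ⊔ y.submodule}

/-- The secant variety `σ(X)`. -/
def secantVariety (X : Set (ℙ ℂ (ι → ℂ))) : Set (ℙ ℂ (ι → ℂ)) :=
  closure (secantPoints X)

/-- The real rank two locus `ρ(X)`. -/
def realRankTwoLocus (X : Set (ℙ ℂ (ι → ℂ))) : Set (ℙ ℝ (ι → ℝ)) :=
  closure (secantPoints (realPoints X))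

/-- The interior of `ρ(X)` relative to the ambient space `σ(X)_ℝ`. -/
def relativeInterior (X : Set (ℙ ℂ (ι → ℂ))) : Set (ℙ ℝ (ι → ℝ)) :=
  Subtype.val '' interior
    (Subtype.val ⁻¹' realRankTwoLocus X : Set (realPoints (secantVariety X)))

/-- The real rank two boundary `∂(ρ(X))`: the locus `ρ(X)` minus its relative interior. -/
def realRankTwoBoundary (X : Set (ℙ ℂ (ι → ℂ))) : Set (ℙ ℝ (ι → ℝ)) :=
  realRankTwoLocus X \ relativeInterior X

end General

/-- Multi-indices of tensors of format `n 0 × ⋯ × n (d-1)`. -/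
abbrev MultiIndex {d : ℕ} (n : Fin d → ℕ) : Type := (j : Fin d) → Fin (n j)

/-- The tensor product of vectors `v j`, in coordinates. -/
def rankOneTensor {K : Type*} [CommSemiring K] {d : ℕ} {n : Fin d → ℕ}
    (v : (j : Fin d) → Fin (n j) → K) : MultiIndex n → K :=
  fun i => ∏ j, v j (i j)

/-- The Segre variety: the rank one tensors as points of complex projective space. -/
def segre {d : ℕ} (n : Fin d → ℕ) : Set (ℙ ℂ (MultiIndex n → ℂ)) :=
  {p | ∃ (v : (j : Fin d) → Fin (n j) → ℂ) (h : rankOneTensor v ≠ 0),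
    p = Projectivization.mk ℂ (rankOneTensor v) h}

/-- Cayley's hyperdeterminant of a `2 × 2 × 2` tensor. -/
def hyperdet {K : Type*} [CommRing K] (x : Fin 2 → Fin 2 → Fin 2 → K) : K :=
  x 0 0 0 ^ 2 * x 1 1 1 ^ 2 + x 0 0 1 ^ 2 * x 1 1 0 ^ 2
    + x 0 1 0 ^ 2 * x 1 0 1 ^ 2 + x 0 1 1 ^ 2 * x 1 0 0 ^ 2
    + 4 * x 0 0 0 * x 0 1 1 * x 1 0 1 * x 1 1 0
    + 4 * x 0 0 1 * x 0 1 0 * x 1 0 0 * x 1 1 1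
    - 2 * x 0 0 0 * x 0 0 1 * x 1 1 0 * x 1 1 1
    - 2 * x 0 0 0 * x 0 1 0 * x 1 0 1 * x 1 1 1
    - 2 * x 0 0 0 * x 0 1 1 * x 1 0 0 * x 1 1 1
    - 2 * x 0 0 1 * x 0 1 0 * x 1 0 1 * x 1 1 0
    - 2 * x 0 0 1 * x 0 1 1 * x 1 0 0 * x 1 1 0
    - 2 * x 0 1 0 * x 0 1 1 * x 1 0 0 * x 1 0 1

/-- The `2 × 2 × 2` sub-tensor of `T` in which the indices in the modes `a`, `b`, `c` take the
two values of `p`, `q`, `r` respectively, and all other indices are fixed as in `i`. -/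
def subTensor {K : Type*} {d : ℕ} {n : Fin d → ℕ} (T : MultiIndex n → K) (i : MultiIndex n)
    (a b c : Fin d) (p : Fin 2 → Fin (n a)) (q : Fin 2 → Fin (n b)) (r : Fin 2 → Fin (n c)) :
    Fin 2 → Fin 2 → Fin 2 → K :=
  fun s t u => T (Function.update (Function.update (Function.update i a (p s)) b (q t)) c (r u))

/-- The tensor `T` has only vanishing `2 × 2 × 2` sub-hyperdeterminants. -/
def SubHyperdetsVanish {K : Type*} [CommRing K] {d : ℕ} {n : Fin d → ℕ}
    (T : MultiIndex n → K) : Prop :=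
  ∀ (i : MultiIndex n) (a b c : Fin d), a < b → b < c →
    ∀ (p : Fin 2 → Fin (n a)) (q : Fin 2 → Fin (n b)) (r : Fin 2 → Fin (n c)),
      p 0 < p 1 → q 0 < q 1 → r 0 < r 1 → hyperdet (subTensor T i a b c p q r) = 0

/-- The variety `Hyp` in complex projective space on which all `2 × 2 × 2`
sub-hyperdeterminants vanish. -/
def hyp {d : ℕ} (n : Fin d → ℕ) : Set (ℙ ℂ (MultiIndex n → ℂ)) :=
  {x | SubHyperdetsVanish x.rep}

/-- The standard basis vector with a one at the zero-based position `k`. -/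
def stdVec {m : ℕ} (k : ℕ) : Fin m → ℝ := fun i => if (i : ℕ) = k then 1 else 0

/-- The tensor `e₁ ⊗ e₁ ⊗ e₁ ⊗ e₁ + e₂ ⊗ e₂ ⊗ e₂ ⊗ e₂`, embedded in the format `n` by tensoring
with `e₁` in every mode after the fourth. -/
def witnessTensor {d : ℕ} (n : Fin d → ℕ) : MultiIndex n → ℝ :=
  rankOneTensor (fun _ => stdVec 0)
    + rankOneTensor (fun j => if (j : ℕ) < 4 then stdVec 1 else stdVec 0)

end

/-!
For a tensor `T`, a mode `a`, two values `p 0`, `p 1` of the index in that mode and two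
multi-indices `i`, `i'`, the contraction of `T` with `x e_{p 0} + y e_{p 1}` has `2 × 2` minors
which exchange the entries of `i` and `i'` in one mode `b` (`swapMinor`). Such a minor is a binary
quadratic form in `(x, y)`, the `pencil` of a `2 × 2 × 2` array `swapTensor T a p b i i'`, and its
discriminant is the hyperdeterminant of that array. If `T = u + v` with `u`, `v` of rank one, all
these forms are multiples of the product of the two linear forms given by `u` and `v`. Hence they
are pairwise proportional, and their discriminants are squares. Proportionality, together with the
vanishing of the `3 × 3` minors of the flattenings, is a closed condition and so holds on all of
the secant variety.

Conversely, let a real `T` satisfy these equations and let one of the discriminants be positive. At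
the two real roots of that form all the others vanish too, so the two contractions of `T` have rank
one; they span the slices of `T`, and `T` is a sum of two real rank one tensors
(`exists_add_of_hyperdet_eq_sq`). Positivity is an open condition, so such a `T` lies in the
relative interior of the real rank two locus (`mem_relativeInterior_of_hyperdet_pos`).

* Sub-hyperdeterminants are nonnegative on the real rank two locus, and a positive one puts a point
  in the relative interior. So all of them vanish on the boundary.
* For four or more modes, the last two of the first four modes of the witness can be grouped: some
  `swapTensor` of it has hyperdeterminant one, although its sub-hyperdeterminants all vanish.
* For three modes, a point of the secant variety is a Tucker product of a `2 × 2 × 2` core, which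
  can be chosen as one of its sub-tensors. A core with hyperdeterminant zero is a limit of cores
  with negative hyperdeterminant (`mem_closure_hyperdet_neg`). The latter have complex rank two, so
  the tensors they give lie on the secant variety, but outside the real rank two locus.
-/

open Function (update)
open Filter Topology

section Algebra

variable {K : Type*} [Field K] {d : ℕ} {n : Fin d → ℕ}

/-! ### Rank one tensors -/

theorem rankOneTensor_mul_apply (v : (j : Fin d) → Fin (n j) → K) (a : Fin d)
    (f : Fin (n a) → K) :
    rankOneTensor (update v a (fun k => f k * v a k)) = fun i => f (i a) * rankOneTensor v i := by
  funext i
  simp only [rankOneTensor]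
  rw [← Finset.mul_prod_erase _ _ (Finset.mem_univ a),
    ← Finset.mul_prod_erase (a := a) _ (fun j => v j (i j)) (Finset.mem_univ a), ← mul_assoc]
  congr 1
  · simp
  · refine Finset.prod_congr rfl fun j hj => ?_
    rw [Function.update_of_ne (Finset.ne_of_mem_erase hj)]

theorem smul_rankOneTensor (v : (j : Fin d) → Fin (n j) → K) (a : Fin d) (c : K) :
    c • rankOneTensor v = rankOneTensor (update v a (fun k => c * v a k)) := by
  rw [rankOneTensor_mul_apply v a (fun _ => c)]
  rfl

/-- The `2 × 2` minor of `S` in which the entries of two multi-indices in the mode `b` are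
exchanged. All of them vanish exactly on the tensors of rank at most one. -/
def swapMinor (S : MultiIndex n → K) (b : Fin d) (i i' : MultiIndex n) : K :=
  S i * S i' - S (update i b (i' b)) * S (update i' b (i b))

/-- A tensor all of whose swap minors vanish has rank at most one: moving the entries of a
multi-index one at a time from a base point `o` with `S o ≠ 0` writes `S` as a product. The mode `a`
only serves to exclude the tensors without modes. -/
theorem exists_rankOneTensor_of_swapMinor (a : Fin d) (S : MultiIndex n → K)
    (hS : ∀ b i i', swapMinor S b i i' = 0) : ∃ v, S = rankOneTensor v := by
  classical
  by_cases h0 : S = 0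
  · refine ⟨fun _ _ => 0, ?_⟩
    funext i
    simp only [h0, rankOneTensor, Pi.zero_apply]
    exact (Finset.prod_eq_zero (Finset.mem_univ a) rfl).symm
  obtain ⟨o, ho⟩ : ∃ o, S o ≠ 0 := by
    by_contra! h
    exact h0 (funext h)
  have key : ∀ (i : MultiIndex n) (s : Finset (Fin d)),
      S (s.piecewise i o) = S o * ∏ j ∈ s, (S (update o j (i j)) / S o) := by
    intro i s
    induction s using Finset.induction_on with
    | empty => simp
    | insert b s hb ih =>
      have h := hS b ((insert b s).piecewise i o) o
      have e1 : update ((insert b s).piecewise i o) b (o b) = s.piecewise i o := by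
        funext j
        by_cases hj : j = b
        · subst hj; simp [hb]
        · simp [hj, Finset.piecewise]
      rw [swapMinor, e1, Finset.piecewise_eq_of_mem _ _ _ (Finset.mem_insert_self b s), ih,
        sub_eq_zero] at h
      rw [Finset.prod_insert hb]
      apply mul_right_cancel₀ ho
      rw [h]
      field_simp
  refine ⟨update (fun j k => S (update o j k) / S o) a
    (fun k => S o * (S (update o a k) / S o)), ?_⟩
  rw [← smul_rankOneTensor (fun j k => S (update o j k) / S o) a (S o)]
  funext i
  have := key i Finset.univ
  simpa [rankOneTensor] using this

/-! ### Pencils of `2 × 2` matrices and the hyperdeterminant -/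

/-- The binary quadratic form `det (x M₀ + y M₁)`, where `M₀` and `M₁` are the slices of a
`2 × 2 × 2` tensor. Its discriminant is the hyperdeterminant. -/
def pencil (k : Fin 2 → Fin 2 → Fin 2 → K) (x y : K) : K :=
  (x * k 0 0 0 + y * k 1 0 0) * (x * k 0 1 1 + y * k 1 1 1)
    - (x * k 0 1 0 + y * k 1 1 0) * (x * k 0 0 1 + y * k 1 0 1)

/-- The hyperdeterminant is the discriminant `β² - 4 α γ` of the pencil `α x² + β x y + γ y²`,
where `α`, `γ` and `α + β + γ` are its values at `(1, 0)`, `(0, 1)` and `(1, 1)`. -/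
theorem hyperdet_eq_discrim (k : Fin 2 → Fin 2 → Fin 2 → K) :
    hyperdet k = (pencil k 1 1 - pencil k 1 0 - pencil k 0 1) ^ 2
      - 4 * pencil k 1 0 * pencil k 0 1 := by
  simp only [hyperdet, pencil]
  ring

theorem pencil_eq (k : Fin 2 → Fin 2 → Fin 2 → K) (x y : K) :
    pencil k x y = pencil k 1 0 * x ^ 2
      + (pencil k 1 1 - pencil k 1 0 - pencil k 0 1) * x * y + pencil k 0 1 * y ^ 2 := by
  simp only [pencil]
  ring

theorem exists_pencil_roots [NeZero (2 : K)] (k : Fin 2 → Fin 2 → Fin 2 → K) {δ : K}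
    (hδ : δ ≠ 0) (hk : hyperdet k = δ ^ 2) :
    ∃ x y x' y' : K, x * y' - x' * y ≠ 0 ∧ pencil k x y = 0 ∧ pencil k x' y' = 0 := by
  have h2 : (2 : K) ≠ 0 := NeZero.ne 2
  rw [hyperdet_eq_discrim] at hk
  suffices h : ∃ x y x' y' : K, x * y' - x' * y ≠ 0 ∧
      pencil k 1 0 * x ^ 2 + (pencil k 1 1 - pencil k 1 0 - pencil k 0 1) * x * y
        + pencil k 0 1 * y ^ 2 = 0 ∧
      pencil k 1 0 * x' ^ 2 + (pencil k 1 1 - pencil k 1 0 - pencil k 0 1) * x' * y'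
        + pencil k 0 1 * y' ^ 2 = 0 by
    obtain ⟨x, y, x', y', h, h1, h2⟩ := h
    exact ⟨x, y, x', y', h, by rw [pencil_eq, h1], by rw [pencil_eq, h2]⟩
  generalize pencil k 1 1 - pencil k 1 0 - pencil k 0 1 = β at *
  generalize pencil k 1 0 = α at *
  generalize pencil k 0 1 = γ at *
  by_cases hα : α = 0
  · subst hα
    refine ⟨1, 0, γ, -β, ?_, by ring, by ring⟩
    intro h
    have hβ : β = 0 := by linear_combination -h
    subst hβ
    apply hδ
    have : δ ^ 2 = 0 := by linear_combination -hk
    exact pow_eq_zero_iff (two_ne_zero) |>.1 this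
  · refine ⟨-β + δ, 2 * α, -β - δ, 2 * α, ?_, by linear_combination (-α) * hk,
      by linear_combination (-α) * hk⟩
    have : (-β + δ) * (2 * α) - (-β - δ) * (2 * α) = 2 * 2 * (δ * α) := by ring
    rw [this]
    exact mul_ne_zero (mul_ne_zero h2 h2) (mul_ne_zero hδ hα)

theorem exists_pencil_ne_zero (k : Fin 2 → Fin 2 → Fin 2 → K) (hk : hyperdet k ≠ 0) :
    ∃ x y, pencil k x y ≠ 0 := by
  by_contra! h
  apply hk
  rw [hyperdet_eq_discrim, h, h, h]
  ring

/-- If the hyperdeterminant is nonzero, the two slices are linearly independent. -/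
theorem exists_slice_minor_ne_zero (k : Fin 2 → Fin 2 → Fin 2 → K) (hk : hyperdet k ≠ 0) :
    ∃ t u t' u', k 0 t u * k 1 t' u' - k 0 t' u' * k 1 t u ≠ 0 := by
  by_contra! h
  apply hk
  have h1 := h 0 0 1 1
  have h2 := h 0 1 1 0
  have h3 := h 0 0 0 1
  have h4 := h 1 0 1 1
  have h5 := h 0 0 1 0
  have h6 := h 0 1 1 1
  simp only [hyperdet]
  linear_combination (k 0 0 0 * k 1 1 1 - k 0 1 1 * k 1 0 0) * h1
    + (k 0 0 1 * k 1 1 0 - k 0 1 0 * k 1 0 1) * h2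
    - 2 * (k 0 0 0 * k 1 0 1 - k 0 0 1 * k 1 0 0) * h4
    - 2 * (k 0 0 0 * k 1 1 0 - k 0 1 0 * k 1 0 0) * h6

theorem exists_mul_of_det_eq_zero (m : Fin 2 → Fin 2 → K) (h : m 0 0 * m 1 1 - m 1 0 * m 0 1 = 0) :
    ∃ y z : Fin 2 → K, ∀ t u, m t u = y t * z u := by
  by_cases h00 : m 0 0 = 0
  · by_cases h01 : m 0 1 = 0
    · exact ⟨![0, 1], m 1, by intro t u; fin_cases t <;> fin_cases u <;> simp [h00, h01]⟩
    · refine ⟨![1, m 1 1 / m 0 1], m 0, ?_⟩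
      have : m 1 0 = 0 := by
        rw [h00] at h
        simpa [h01] using h
      intro t u
      fin_cases t <;> fin_cases u <;> simp [h00, h01, this]
  · refine ⟨![1, m 1 0 / m 0 0], m 0, ?_⟩
    intro t u
    fin_cases t <;> fin_cases u <;> simp [h00]
    field_simp
    linear_combination h

/-- A `2 × 2 × 2` tensor whose hyperdeterminant is a nonzero square has rank at most two: the two
singular members of its pencil of slices have rank one. -/
theorem exists_rank_two_of_hyperdet_eq_sq [NeZero (2 : K)] (k : Fin 2 → Fin 2 → Fin 2 → K) {δ : K}
    (hδ : δ ≠ 0) (hk : hyperdet k = δ ^ 2) :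
    ∃ x y z x' y' z' : Fin 2 → K, ∀ s t u, k s t u = x s * y t * z u + x' s * y' t * z' u := by
  obtain ⟨x, y, x', y', hD, hr, hr'⟩ := exists_pencil_roots k hδ hk
  obtain ⟨b, c, h⟩ := exists_mul_of_det_eq_zero (fun t u => x * k 0 t u + y * k 1 t u) hr
  obtain ⟨b', c', h'⟩ := exists_mul_of_det_eq_zero (fun t u => x' * k 0 t u + y' * k 1 t u) hr'
  obtain ⟨e, he⟩ : ∃ e, (x * y' - x' * y) * e = 1 := ⟨_, mul_inv_cancel₀ hD⟩
  refine ⟨![y' * e, - x' * e], b, c, ![- y * e, x * e], b', c', ?_⟩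
  intro s t u
  fin_cases s
  · simp only [Fin.zero_eta, Matrix.cons_val_zero, mul_assoc, ← h, ← h']
    linear_combination (-k 0 t u) * he
  · simp only [Fin.mk_one, Matrix.cons_val_one, Matrix.cons_val_zero, mul_assoc, ← h, ← h']
    linear_combination (-k 1 t u) * he

/-! ### Equations of the secant variety -/

/-- The `2 × 2 × 2` array obtained from `T` by letting the index in the mode `a` take the two
values of `p`, letting the index in the mode `b` be taken from `i` or `i'`, and taking the
remaining indices, jointly, from `i` or `i'`. The sub-tensors in the modes `a`, `b`, `c` are the
case in which `i` and `i'` differ in `b` and `c` only. -/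
def swapTensor {R : Type*} (T : MultiIndex n → R) (a : Fin d) (p : Fin 2 → Fin (n a)) (b : Fin d)
    (i i' : MultiIndex n) : Fin 2 → Fin 2 → Fin 2 → R :=
  fun s t u => T (update (update (![i, i'] u) b (![i b, i' b] t)) a (p s))

theorem subTensor_eq_swapTensor {R : Type*} (T : MultiIndex n → R) (i : MultiIndex n)
    {a b c : Fin d} (hab : a < b) (hbc : b < c) (p : Fin 2 → Fin (n a)) (q : Fin 2 → Fin (n b))
    (r : Fin 2 → Fin (n c)) :
    subTensor T i a b c p q r = swapTensor T a p b (update (update i b (q 0)) c (r 0))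
      (update (update i b (q 1)) c (r 1)) := by
  have hac := hab.trans hbc
  funext s t u
  simp only [subTensor, swapTensor]
  congr 1
  rw [Function.update_comm hab.ne, Function.update_comm hac.ne]
  fin_cases t <;> fin_cases u <;>
    simp [hbc.ne, Function.update_comm hbc.ne']

/-- The contraction of `T` in the mode `a` with the functional that takes the values `x` and `y`
on the basis vectors `p 0` and `p 1`; it is written as a tensor of the same format that does not
depend on the index in the mode `a`. -/
def contraction (T : MultiIndex n → K) (a : Fin d) (p : Fin 2 → Fin (n a)) (x y : K) :
    MultiIndex n → K :=
  fun i => x * T (update i a (p 0)) + y * T (update i a (p 1))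

theorem swapMinor_contraction (T : MultiIndex n → K) (a : Fin d) (p : Fin 2 → Fin (n a)) (x y : K)
    (b : Fin d) (i i' : MultiIndex n) :
    swapMinor (contraction T a p x y) b i i' = pencil (swapTensor T a p b i i') x y := by
  simp [swapMinor, contraction, pencil, swapTensor]

/-- The flattening of `T` in the mode `a` has rank at most two: its `3 × 3` minors vanish. -/
def FlatteningMinorsVanish (T : MultiIndex n → K) (a : Fin d) : Prop :=
  ∀ (l m k : Fin (n a)) (i i' i'' : MultiIndex n),
    T (update i a l) * (T (update i' a m) * T (update i'' a k)
        - T (update i'' a m) * T (update i' a k))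
      - T (update i a m) * (T (update i' a l) * T (update i'' a k)
        - T (update i'' a l) * T (update i' a k))
      + T (update i a k) * (T (update i' a l) * T (update i'' a m)
        - T (update i'' a l) * T (update i' a m)) = 0

/-- The pencils of any two `2 × 2 × 2` arrays with the same two values in the mode `a` are
proportional. -/
def PencilsProportional (T : MultiIndex n → K) (a : Fin d) : Prop :=
  ∀ (p : Fin 2 → Fin (n a)) (b : Fin d) (i i' : MultiIndex n) (c : Fin d) (j j' : MultiIndex n)
    (x y x' y' : K),
    pencil (swapTensor T a p b i i') x y * pencil (swapTensor T a p c j j') x' y' =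
      pencil (swapTensor T a p b i i') x' y' * pencil (swapTensor T a p c j j') x y

/-- The product of the coordinates in all modes but `a`. -/
def cofactor (v : (j : Fin d) → Fin (n j) → K) (a : Fin d) (i : MultiIndex n) : K :=
  ∏ j ∈ Finset.univ.erase a, v j (i j)

theorem rankOneTensor_update (v : (j : Fin d) → Fin (n j) → K) (a : Fin d) (i : MultiIndex n)
    (l : Fin (n a)) : rankOneTensor v (update i a l) = v a l * cofactor v a i := by
  rw [rankOneTensor, ← Finset.mul_prod_erase _ _ (Finset.mem_univ a), cofactor]
  congr 1
  · simp
  · refine Finset.prod_congr rfl fun j hj => ?_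
    rw [Function.update_of_ne (Finset.ne_of_mem_erase hj)]

theorem prod_swap (v : (j : Fin d) → Fin (n j) → K) (s : Finset (Fin d)) (b : Fin d)
    (i i' : MultiIndex n) :
    (∏ j ∈ s, v j (i j)) * ∏ j ∈ s, v j (i' j) =
      (∏ j ∈ s, v j (update i b (i' b) j)) * ∏ j ∈ s, v j (update i' b (i b) j) := by
  simp only [← Finset.prod_mul_distrib]
  refine Finset.prod_congr rfl fun j _ => ?_
  by_cases hj : j = b
  · subst hj
    simp [mul_comm]
  · simp [hj]

theorem cofactor_swap (v : (j : Fin d) → Fin (n j) → K) (a b : Fin d) (i i' : MultiIndex n) :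
    cofactor v a i * cofactor v a i' =
      cofactor v a (update i b (i' b)) * cofactor v a (update i' b (i b)) :=
  prod_swap v _ b i i'

theorem swapMinor_rankOneTensor (v : (j : Fin d) → Fin (n j) → K) (b : Fin d)
    (i i' : MultiIndex n) : swapMinor (rankOneTensor v) b i i' = 0 :=
  sub_eq_zero.2 (prod_swap v _ b i i')

/-- The factor by which the pencil of a swap of a sum of two rank one tensors differs from the
product of the two linear forms given by the vectors in the mode `a`. -/
def pencilFactor (v w : (j : Fin d) → Fin (n j) → K) (a b : Fin d) (i i' : MultiIndex n) : K :=
  cofactor v a i * cofactor w a i' + cofactor w a i * cofactor v a i'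
    - cofactor v a (update i b (i' b)) * cofactor w a (update i' b (i b))
    - cofactor w a (update i b (i' b)) * cofactor v a (update i' b (i b))

theorem pencil_swapTensor_add (v w : (j : Fin d) → Fin (n j) → K) (a : Fin d)
    (p : Fin 2 → Fin (n a)) (b : Fin d) (i i' : MultiIndex n) (x y : K) :
    pencil (swapTensor (rankOneTensor v + rankOneTensor w) a p b i i') x y =
      (x * v a (p 0) + y * v a (p 1)) * (x * w a (p 0) + y * w a (p 1))
        * pencilFactor v w a b i i' := by
  rw [← swapMinor_contraction]
  simp only [swapMinor, contraction, Pi.add_apply, rankOneTensor_update, pencilFactor]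
  linear_combination (x * v a (p 0) + y * v a (p 1)) ^ 2 * cofactor_swap v a b i i'
    + (x * w a (p 0) + y * w a (p 1)) ^ 2 * cofactor_swap w a b i i'

theorem hyperdet_swapTensor_add (v w : (j : Fin d) → Fin (n j) → K) (a : Fin d)
    (p : Fin 2 → Fin (n a)) (b : Fin d) (i i' : MultiIndex n) :
    hyperdet (swapTensor (rankOneTensor v + rankOneTensor w) a p b i i') =
      ((v a (p 0) * w a (p 1) - v a (p 1) * w a (p 0)) * pencilFactor v w a b i i') ^ 2 := by
  simp only [hyperdet_eq_discrim, pencil_swapTensor_add]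
  ring

theorem pencilsProportional_add (v w : (j : Fin d) → Fin (n j) → K) (a : Fin d) :
    PencilsProportional (rankOneTensor v + rankOneTensor w) a := by
  intro p b i i' c j j' x y x' y'
  simp only [pencil_swapTensor_add]
  ring

theorem flatteningMinorsVanish_add (v w : (j : Fin d) → Fin (n j) → K) (a : Fin d) :
    FlatteningMinorsVanish (rankOneTensor v + rankOneTensor w) a := by
  intro l m k i i' i''
  simp only [Pi.add_apply, rankOneTensor_update]
  ring

/-- Cramer's rule: if the flattening in the mode `a` has rank two and the slices at `p 0` and
`p 1` are independent, every slice is a combination of these two. -/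
theorem exists_slice_combination {T : MultiIndex n → K} {a : Fin d}
    (hT : FlatteningMinorsVanish T a) {p : Fin 2 → Fin (n a)} {k k' : MultiIndex n}
    (hk : T (update k a (p 0)) * T (update k' a (p 1))
      - T (update k' a (p 0)) * T (update k a (p 1)) ≠ 0) :
    ∃ A : Fin 2 → Fin (n a) → K, (∀ s t, A s (p t) = if s = t then 1 else 0) ∧
      ∀ i l, T (update i a l) = A 0 l * T (update i a (p 0)) + A 1 l * T (update i a (p 1)) := by
  obtain ⟨e, he⟩ : ∃ e, (T (update k a (p 0)) * T (update k' a (p 1))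
      - T (update k' a (p 0)) * T (update k a (p 1))) * e = 1 := ⟨_, mul_inv_cancel₀ hk⟩
  refine ⟨![fun l => (T (update k a l) * T (update k' a (p 1))
      - T (update k' a l) * T (update k a (p 1))) * e,
    fun l => (T (update k a (p 0)) * T (update k' a l)
      - T (update k' a (p 0)) * T (update k a l)) * e], ?_, ?_⟩
  · intro s t
    fin_cases s <;> fin_cases t <;> simp [he]
    · exact Or.inl (by ring)
    · exact Or.inl (by ring)
  · intro i l
    have h := hT l (p 0) (p 1) i k k'
    simp only [Matrix.cons_val_zero, Matrix.cons_val_one]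
    linear_combination e * h - T (update i a l) * he

/-- On a tensor that satisfies the equations of the secant variety, a nonzero square
hyperdeterminant forces rank at most two: contracting with either root of the pencil kills one of
the two summands and leaves a rank one tensor, and these two contractions span the slices. -/
theorem exists_add_of_hyperdet_eq_sq [NeZero (2 : K)] {T : MultiIndex n → K} {a : Fin d}
    (h3 : FlatteningMinorsVanish T a) (hP : PencilsProportional T a) {p : Fin 2 → Fin (n a)}
    {b : Fin d} {i i' : MultiIndex n} {δ : K} (hδ : δ ≠ 0)
    (hk : hyperdet (swapTensor T a p b i i') = δ ^ 2) :
    ∃ v w, T = rankOneTensor v + rankOneTensor w := by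
  have hk0 : hyperdet (swapTensor T a p b i i') ≠ 0 := by
    rw [hk]
    exact pow_ne_zero 2 hδ
  obtain ⟨x₀, y₀, h₀⟩ := exists_pencil_ne_zero _ hk0
  have rank_one : ∀ x y, pencil (swapTensor T a p b i i') x y = 0 →
      ∃ v, contraction T a p x y = rankOneTensor v := by
    intro x y hxy
    refine exists_rankOneTensor_of_swapMinor a _ fun c j j' => ?_
    rw [swapMinor_contraction]
    have h := hP p b i i' c j j' x y x₀ y₀
    rw [hxy, zero_mul, eq_comm] at h
    exact (mul_eq_zero.1 h).resolve_left h₀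
  obtain ⟨x, y, x', y', hD, hr, hr'⟩ := exists_pencil_roots _ hδ hk
  obtain ⟨v, hv⟩ := rank_one x y hr
  obtain ⟨w, hw⟩ := rank_one x' y' hr'
  obtain ⟨t, u, t', u', hm⟩ := exists_slice_minor_ne_zero _ hk0
  obtain ⟨A, -, hA⟩ := exists_slice_combination h3 (p := p) hm
  obtain ⟨e, he⟩ : ∃ e, (x * y' - x' * y) * e = 1 := ⟨_, mul_inv_cancel₀ hD⟩
  refine ⟨update v a (fun l => (A 0 l * y' - A 1 l * x') * e * v a l),
    update w a (fun l => (A 1 l * x - A 0 l * y) * e * w a l), ?_⟩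
  rw [rankOneTensor_mul_apply v a (fun l => (A 0 l * y' - A 1 l * x') * e),
    rankOneTensor_mul_apply w a (fun l => (A 1 l * x - A 0 l * y) * e), ← hv, ← hw]
  funext j
  have h := hA j (j a)
  rw [Function.update_eq_self] at h
  simp only [Pi.add_apply, contraction]
  linear_combination h - (A 0 (j a) * T (update j a (p 0))
    + A 1 (j a) * T (update j a (p 1))) * he

end Algebra

/-! ### Cones and the Euclidean topology of projective space -/

section Projective

variable {K V : Type*} [Field K] [AddCommGroup V] [Module K V]

theorem Projectivization.rep_mk_iff {P : V → Prop} (hs : ∀ c : K, c ≠ 0 → ∀ v, P v → P (c • v))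
    {v : V} (hv : v ≠ 0) : P (Projectivization.mk K v hv).rep ↔ P v := by
  obtain ⟨c, hc⟩ := Projectivization.exists_smul_eq_mk_rep K v hv
  rw [← hc]
  refine ⟨fun h => ?_, fun h => hs c c.ne_zero v h⟩
  have := hs (c⁻¹ : Kˣ) (c⁻¹).ne_zero _ h
  change P (c⁻¹ • c • v) at this
  rwa [inv_smul_smul] at this

variable [TopologicalSpace V]

theorem Projectivization.isOpen_setOf_rep {P : V → Prop} (hP : IsOpen {v | P v})
    (hs : ∀ c : K, c ≠ 0 → ∀ v, P v → P (c • v)) : IsOpen {p : ℙ K V | P p.rep} := by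
  rw [isOpen_coinduced]
  convert hP.preimage continuous_subtype_val using 1
  ext v
  exact rep_mk_iff hs v.2

theorem Projectivization.isClosed_setOf_rep {P : V → Prop} (hP : IsClosed {v | P v})
    (hs : ∀ c : K, c ≠ 0 → ∀ v, P v → P (c • v)) : IsClosed {p : ℙ K V | P p.rep} := by
  rw [← isOpen_compl_iff]
  refine isOpen_setOf_rep (P := fun v => ¬ P v) hP.isOpen_compl fun c hc v hv h => hv ?_
  have := hs c⁻¹ (inv_ne_zero hc) _ h
  rwa [inv_smul_smul₀ hc] at this

/-- A closed homogeneous condition passes from a set of points to its closure. -/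
theorem Projectivization.of_mk_mem_closure {P : V → Prop} (hP : IsClosed {v | P v})
    (hs : ∀ c : K, c ≠ 0 → ∀ v, P v → P (c • v)) {S : Set (ℙ K V)}
    (hS : ∀ v hv, Projectivization.mk K v hv ∈ S → P v) {v : V} (hv : v ≠ 0)
    (h : Projectivization.mk K v hv ∈ closure S) : P v := by
  refine (rep_mk_iff hs hv).1 (closure_minimal (t := {p : ℙ K V | P p.rep}) (fun p hp => ?_)
    (isClosed_setOf_rep hP hs) h)
  exact hS p.rep p.rep_nonzero (by rwa [p.mk_rep])

end Projective

theorem complexifyVec_apply {ι : Type*} (T : ι → ℝ) (i : ι) : complexifyVec ι T i = (T i : ℂ) :=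
  rfl

theorem continuous_complexify (ι : Type*) : Continuous (complexify ι) := by
  rw [continuous_coinduced_dom]
  have hc : Continuous (fun v : {v : ι → ℝ // v ≠ 0} =>
      (⟨complexifyVec ι v, (map_ne_zero_iff (complexifyVec ι) (complexifyVec_injective ι)).2 v.2⟩ :
        {v : ι → ℂ // v ≠ 0})) := by
    refine Continuous.subtype_mk ?_ _
    refine continuous_pi fun i => ?_
    exact Complex.continuous_ofReal.comp ((continuous_apply i).comp continuous_subtype_val)
  exact continuous_coinduced_rng.comp hc

theorem complexify_mk {ι : Type*} (T : ι → ℝ) (hT : T ≠ 0) :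
    complexify ι (Projectivization.mk ℝ T hT) = Projectivization.mk ℂ (complexifyVec ι T)
      ((map_ne_zero_iff (complexifyVec ι) (complexifyVec_injective ι)).2 hT) :=
  rfl

/-! ### Secant points of the Segre variety -/

section Secant

variable {K : Type*} [Field K] {d : ℕ} {n : Fin d → ℕ}

/-- The points of projective space over `K` that are represented by rank one tensors. -/
def rankOnePoints (K : Type*) [Field K] {d : ℕ} (n : Fin d → ℕ) : Set (ℙ K (MultiIndex n → K)) :=
  {p | ∃ (v : (j : Fin d) → Fin (n j) → K) (h : rankOneTensor v ≠ 0),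
    p = Projectivization.mk K (rankOneTensor v) h}

theorem exists_ne_mem_rankOnePoints {a : Fin d} (ha : 2 ≤ n a) (hn : ∀ j, 0 < n j)
    (p : ℙ K (MultiIndex n → K)) : ∃ q ∈ rankOnePoints K n, p ≠ q := by
  classical
  let i : MultiIndex n := fun j => ⟨0, hn j⟩
  let i' : MultiIndex n := update i a ⟨1, ha⟩
  have hii : i a ≠ i' a := by simp [i, i', Fin.ext_iff]
  let e : MultiIndex n → (j : Fin d) → Fin (n j) → K := fun k j => Pi.single (k j) 1
  have he : ∀ k, rankOneTensor (e k) k = 1 := fun k => by simp [rankOneTensor, e]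
  have hne : ∀ k, rankOneTensor (e k) ≠ 0 := fun k h => by
    have := he k
    rw [h] at this
    exact zero_ne_one this
  by_cases h : p = Projectivization.mk K _ (hne i)
  · refine ⟨Projectivization.mk K _ (hne i'), ⟨_, _, rfl⟩, fun h' => ?_⟩
    obtain ⟨c, hc⟩ := (Projectivization.mk_eq_mk_iff' K _ _ (hne i) (hne i')).1 (h.symm.trans h')
    have h1 := congrFun hc i
    have h0 : rankOneTensor (e i') i = 0 :=
      Finset.prod_eq_zero (Finset.mem_univ a) (by simp [e, hii])
    rw [he, Pi.smul_apply, h0, smul_zero] at h1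
    exact zero_ne_one h1
  · exact ⟨_, ⟨_, _, rfl⟩, h⟩

/-- Sums of two rank one tensors represent exactly the secant points. A tensor of rank one is such
a point because there is a second point of the Segre variety to span a line with. -/
theorem mk_mem_secantPoints_iff {a : Fin d} (hn : ∀ j, 2 ≤ n j) {T : MultiIndex n → K}
    (hT : T ≠ 0) : Projectivization.mk K T hT ∈ secantPoints (rankOnePoints K n) ↔
      ∃ v w, T = rankOneTensor v + rankOneTensor w := by
  constructor
  · rintro ⟨_, ⟨v, hv, rfl⟩, _, ⟨w, hw, rfl⟩, -, h⟩
    simp only [Projectivization.submodule_mk] at h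
    have hmem := h (Submodule.mem_span_singleton_self T)
    obtain ⟨_, hy, _, hz, rfl⟩ := Submodule.mem_sup.1 hmem
    obtain ⟨c, rfl⟩ := Submodule.mem_span_singleton.1 hy
    obtain ⟨c', rfl⟩ := Submodule.mem_span_singleton.1 hz
    rw [smul_rankOneTensor v a, smul_rankOneTensor w a]
    exact ⟨_, _, rfl⟩
  · rintro ⟨v, w, h⟩
    have rank_one : ∀ z, T = rankOneTensor z →
        Projectivization.mk K T hT ∈ secantPoints (rankOnePoints K n) := by
      rintro z rfl
      obtain ⟨q, hq, hne⟩ := exists_ne_mem_rankOnePoints (hn a)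
        (fun j => two_pos.trans_le (hn j)) (Projectivization.mk K _ hT)
      exact ⟨_, ⟨z, hT, rfl⟩, q, hq, hne, le_sup_left⟩
    by_cases hv : rankOneTensor v = 0
    · exact rank_one w (by rw [h, hv, zero_add])
    by_cases hw : rankOneTensor w = 0
    · exact rank_one v (by rw [h, hw, add_zero])
    by_cases hvw : Projectivization.mk K _ hv = Projectivization.mk K _ hw
    · obtain ⟨c, hc⟩ := (Projectivization.mk_eq_mk_iff' K _ _ hv hw).1 hvw
      refine rank_one (update w a fun k => (c + 1) * w a k) ?_
      rw [h, ← hc, ← smul_rankOneTensor, add_smul, one_smul]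
    · refine ⟨_, ⟨v, hv, rfl⟩, _, ⟨w, hw, rfl⟩, hvw, ?_⟩
      simp only [Projectivization.submodule_mk, Submodule.span_singleton_le_iff_mem]
      rw [h]
      exact Submodule.add_mem_sup (Submodule.mem_span_singleton_self _)
        (Submodule.mem_span_singleton_self _)

end Secant

section Real

variable {d : ℕ} {n : Fin d → ℕ}

theorem complexifyVec_rankOneTensor (v : (j : Fin d) → Fin (n j) → ℝ) :
    complexifyVec _ (rankOneTensor v) = rankOneTensor (fun j k => (v j k : ℂ)) := by
  funext i
  simp [complexifyVec, rankOneTensor]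

/-- The real points of the Segre variety are the real rank one tensors. -/
theorem realPoints_segre (a : Fin d) : realPoints (segre n) = rankOnePoints ℝ n := by
  ext p
  induction p using Projectivization.ind with | h T hT => ?_
  constructor
  · rintro ⟨v, hv, h⟩
    rw [complexify_mk] at h
    obtain ⟨c, hc⟩ := (Projectivization.mk_eq_mk_iff' ℂ _ _ _ hv).1 h
    rw [smul_rankOneTensor v a] at hc
    obtain ⟨w, hw⟩ := exists_rankOneTensor_of_swapMinor a T fun b i i' => by
      have := swapMinor_rankOneTensor (update v a fun k => c * v a k) b i i'
      rw [hc] at this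
      simp only [swapMinor, complexifyVec_apply] at this ⊢
      exact_mod_cast this
    subst hw
    exact ⟨w, hT, rfl⟩
  · rintro ⟨v, hv, h⟩
    obtain ⟨c, hc⟩ := (Projectivization.mk_eq_mk_iff' ℝ _ _ _ hv).1 h
    refine ⟨fun j k => ((update v a (fun k => c * v a k) j k : ℝ) : ℂ), ?_, ?_⟩
    · rw [← complexifyVec_rankOneTensor, ← smul_rankOneTensor, hc]
      exact (map_ne_zero_iff (complexifyVec _) (complexifyVec_injective _)).2 hT
    · rw [complexify_mk]
      congr 1
      rw [← complexifyVec_rankOneTensor, ← smul_rankOneTensor, hc]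

theorem mk_mem_real_secantPoints_iff {a : Fin d} (hn : ∀ j, 2 ≤ n j) {T : MultiIndex n → ℝ}
    (hT : T ≠ 0) : Projectivization.mk ℝ T hT ∈ secantPoints (realPoints (segre n)) ↔
      ∃ v w, T = rankOneTensor v + rankOneTensor w := by
  rw [realPoints_segre a, mk_mem_secantPoints_iff (a := a) hn]

theorem mk_mem_realPoints_secantVariety {a : Fin d} (hn : ∀ j, 2 ≤ n j) {T : MultiIndex n → ℝ}
    (hT : T ≠ 0) {v w : (j : Fin d) → Fin (n j) → ℂ}
    (h : complexifyVec _ T = rankOneTensor v + rankOneTensor w) :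
    Projectivization.mk ℝ T hT ∈ realPoints (secantVariety (segre n)) := by
  change complexify _ (Projectivization.mk ℝ T hT) ∈ secantVariety (segre n)
  rw [complexify_mk]
  exact subset_closure ((mk_mem_secantPoints_iff (a := a) hn _).2 ⟨v, w, h⟩)

theorem realRankTwoLocus_subset {a : Fin d} (hn : ∀ j, 2 ≤ n j) :
    realRankTwoLocus (segre n) ⊆ realPoints (secantVariety (segre n)) := by
  refine closure_minimal ?_ (isClosed_closure.preimage (continuous_complexify _))
  intro p
  induction p using Projectivization.ind with | h T hT => ?_
  intro hp
  obtain ⟨v, w, h⟩ := (mk_mem_real_secantPoints_iff (a := a) hn hT).1 hp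
  refine mk_mem_realPoints_secantVariety (a := a) hn hT (v := fun j k => (v j k : ℂ))
    (w := fun j k => (w j k : ℂ)) ?_
  rw [h, map_add, complexifyVec_rankOneTensor, complexifyVec_rankOneTensor]

/-! ### Homogeneity -/

theorem hyperdet_smul {K : Type*} [Field K] (c : K) (k : Fin 2 → Fin 2 → Fin 2 → K) :
    hyperdet (c • k) = c ^ 4 * hyperdet k := by
  simp only [hyperdet, Pi.smul_apply, smul_eq_mul]
  ring

theorem pencil_smul {K : Type*} [Field K] (c : K) (k : Fin 2 → Fin 2 → Fin 2 → K) (x y : K) :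
    pencil (c • k) x y = c ^ 2 * pencil k x y := by
  simp only [pencil, Pi.smul_apply, smul_eq_mul]
  ring

theorem swapTensor_smul {K : Type*} [Field K] (c : K) (T : MultiIndex n → K) (a : Fin d)
    (p : Fin 2 → Fin (n a)) (b : Fin d) (i i' : MultiIndex n) :
    swapTensor (c • T) a p b i i' = c • swapTensor T a p b i i' :=
  rfl

theorem subTensor_smul {K : Type*} [Field K] (c : K) (T : MultiIndex n → K) (i : MultiIndex n)
    (a b c' : Fin d) (p : Fin 2 → Fin (n a)) (q : Fin 2 → Fin (n b)) (r : Fin 2 → Fin (n c')) :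
    subTensor (c • T) i a b c' p q r = c • subTensor T i a b c' p q r :=
  rfl

theorem FlatteningMinorsVanish.smul {K : Type*} [Field K] {T : MultiIndex n → K} {a : Fin d}
    (h : FlatteningMinorsVanish T a) (c : K) : FlatteningMinorsVanish (c • T) a := by
  intro l m k i i' i''
  simp only [Pi.smul_apply, smul_eq_mul]
  linear_combination c ^ 3 * h l m k i i' i''

theorem PencilsProportional.smul {K : Type*} [Field K] {T : MultiIndex n → K} {a : Fin d}
    (h : PencilsProportional T a) (c : K) : PencilsProportional (c • T) a := by
  intro p b i i' e j j' x y x' y'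
  simp only [swapTensor_smul, pencil_smul]
  linear_combination c ^ 4 * h p b i i' e j j' x y x' y'

theorem SubHyperdetsVanish.smul {K : Type*} [Field K] {T : MultiIndex n → K}
    (h : SubHyperdetsVanish T) (c : K) : SubHyperdetsVanish (c • T) := by
  intro i a b c' hab hbc p q r hp hq hr
  rw [subTensor_smul, hyperdet_smul, h i a b c' hab hbc p q r hp hq hr, mul_zero]

theorem hyperdet_ofReal (k : Fin 2 → Fin 2 → Fin 2 → ℝ) :
    hyperdet (fun s t u => (k s t u : ℂ)) = (hyperdet k : ℝ) := by
  simp only [hyperdet]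
  push_cast
  rfl

theorem mk_mem_realPoints_hyp_iff {T : MultiIndex n → ℝ} (hT : T ≠ 0) :
    Projectivization.mk ℝ T hT ∈ realPoints (hyp n) ↔ SubHyperdetsVanish T := by
  have hs : ∀ c : ℂ, c ≠ 0 → ∀ v : MultiIndex n → ℂ, SubHyperdetsVanish v →
      SubHyperdetsVanish (c • v) := fun c _ v h => h.smul c
  have hT' : SubHyperdetsVanish (complexifyVec _ T) ↔ SubHyperdetsVanish T := by
    have key : ∀ i a b c p q r, hyperdet (subTensor (n := n) (complexifyVec _ T) i a b c p q r) =
        (hyperdet (subTensor T i a b c p q r) : ℝ) :=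
      fun i a b c p q r => hyperdet_ofReal (subTensor T i a b c p q r)
    simp only [SubHyperdetsVanish, key, Complex.ofReal_eq_zero]
  exact (Projectivization.rep_mk_iff hs _).trans hT'

/-! ### The relative interior of the real rank two locus -/

theorem continuous_hyperdet {R : Type*} [CommRing R] [TopologicalSpace R] [IsTopologicalRing R] :
    Continuous (hyperdet : (Fin 2 → Fin 2 → Fin 2 → R) → R) := by
  unfold hyperdet
  fun_prop

/-- The closed conditions satisfied by sums of two complex rank one tensors hold at the real points
of the secant variety. -/
theorem secant_equations {T : MultiIndex n → ℝ} (hT : T ≠ 0) {a : Fin d} (hn : ∀ j, 2 ≤ n j)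
    (h : Projectivization.mk ℝ T hT ∈ realPoints (secantVariety (segre n))) :
    FlatteningMinorsVanish T a ∧ PencilsProportional T a := by
  have hs : ∀ c : ℂ, c ≠ 0 → ∀ v : MultiIndex n → ℂ,
      FlatteningMinorsVanish v a ∧ PencilsProportional v a →
      FlatteningMinorsVanish (c • v) a ∧ PencilsProportional (c • v) a :=
    fun c _ v h => ⟨h.1.smul c, h.2.smul c⟩
  have hclosed : IsClosed {v : MultiIndex n → ℂ |
      FlatteningMinorsVanish v a ∧ PencilsProportional v a} := by
    refine IsClosed.and ?_ ?_
    · simp only [FlatteningMinorsVanish, Set.ofPred_forall]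
      iterate 6 refine isClosed_iInter fun _ => ?_
      exact isClosed_eq (by fun_prop) (by fun_prop)
    · simp only [PencilsProportional, Set.ofPred_forall]
      iterate 11 refine isClosed_iInter fun _ => ?_
      simp only [pencil, swapTensor]
      exact isClosed_eq (by fun_prop) (by fun_prop)
  obtain ⟨h1, h2⟩ := Projectivization.of_mk_mem_closure hclosed hs (fun v hv hv' => by
    obtain ⟨x, y, rfl⟩ := (mk_mem_secantPoints_iff (a := a) hn hv).1 hv'
    exact ⟨flatteningMinorsVanish_add x y a, pencilsProportional_add x y a⟩)
    ((map_ne_zero_iff (complexifyVec _) (complexifyVec_injective _)).2 hT) h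
  refine ⟨fun l m k i i' i'' => ?_, fun p b i i' c j j' x y x' y' => ?_⟩
  · have := h1 l m k i i' i''
    simp only [complexifyVec_apply] at this
    exact_mod_cast this
  · have := h2 p b i i' c j j' x y x' y'
    simp only [complexifyVec_apply, pencil, swapTensor] at this ⊢
    exact_mod_cast this

theorem mem_realRankTwoLocus_of_hyperdet_pos {T : MultiIndex n → ℝ} (hT : T ≠ 0) {a : Fin d}
    (hn : ∀ j, 2 ≤ n j) (h : Projectivization.mk ℝ T hT ∈ realPoints (secantVariety (segre n)))
    {p : Fin 2 → Fin (n a)} {b : Fin d} {i i' : MultiIndex n}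
    (hpos : 0 < hyperdet (swapTensor T a p b i i')) :
    Projectivization.mk ℝ T hT ∈ realRankTwoLocus (segre n) := by
  obtain ⟨h3, hP⟩ := secant_equations (a := a) hT hn h
  exact subset_closure ((mk_mem_real_secantPoints_iff (a := a) hn hT).2
    (exists_add_of_hyperdet_eq_sq h3 hP (Real.sqrt_pos.2 hpos).ne' (Real.sq_sqrt hpos.le).symm))

/-- A real point of the secant variety with a positive hyperdeterminant lies in the relative
interior of the real rank two locus, since positivity is an open condition. -/
theorem mem_relativeInterior_of_hyperdet_pos {T : MultiIndex n → ℝ} (hT : T ≠ 0) {a : Fin d}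
    (hn : ∀ j, 2 ≤ n j) (h : Projectivization.mk ℝ T hT ∈ realPoints (secantVariety (segre n)))
    {p : Fin 2 → Fin (n a)} {b : Fin d} {i i' : MultiIndex n}
    (hpos : 0 < hyperdet (swapTensor T a p b i i')) :
    Projectivization.mk ℝ T hT ∈ relativeInterior (segre n) := by
  have hs : ∀ c : ℝ, c ≠ 0 → ∀ v : MultiIndex n → ℝ, 0 < hyperdet (swapTensor v a p b i i') →
      0 < hyperdet (swapTensor (c • v) a p b i i') := by
    intro c hc v hv
    rw [swapTensor_smul, hyperdet_smul]
    positivity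
  have hopen : IsOpen {q : ℙ ℝ (MultiIndex n → ℝ) |
      0 < hyperdet (swapTensor q.rep a p b i i')} := by
    refine Projectivization.isOpen_setOf_rep
      (P := fun v => 0 < hyperdet (swapTensor v a p b i i')) ?_ hs
    refine isOpen_lt continuous_const (continuous_hyperdet.comp ?_)
    unfold swapTensor
    fun_prop
  refine ⟨⟨_, h⟩, mem_interior.2 ⟨_, ?_, hopen.preimage continuous_subtype_val,
    (Projectivization.rep_mk_iff hs hT).2 hpos⟩, rfl⟩
  rintro ⟨q, hq⟩ hq'
  induction q using Projectivization.ind with | h S hS => ?_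
  exact mem_realRankTwoLocus_of_hyperdet_pos hS hn hq
    ((Projectivization.rep_mk_iff hs hS).1 hq')

/-- On a sum of two real rank one tensors the sub-hyperdeterminants are squares, and nonnegativity
is a closed condition. -/
theorem hyperdet_subTensor_nonneg {T : MultiIndex n → ℝ} (hT : T ≠ 0) (hn : ∀ j, 2 ≤ n j)
    (h : Projectivization.mk ℝ T hT ∈ realRankTwoLocus (segre n)) (i : MultiIndex n)
    {a b c : Fin d} (hab : a < b) (hbc : b < c) (p : Fin 2 → Fin (n a)) (q : Fin 2 → Fin (n b))
    (r : Fin 2 → Fin (n c)) : 0 ≤ hyperdet (subTensor T i a b c p q r) := by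
  have hs : ∀ e : ℝ, e ≠ 0 → ∀ v : MultiIndex n → ℝ, 0 ≤ hyperdet (subTensor v i a b c p q r) →
      0 ≤ hyperdet (subTensor (e • v) i a b c p q r) := by
    intro e he v hv
    rw [subTensor_smul, hyperdet_smul]
    positivity
  have hclosed : IsClosed {v : MultiIndex n → ℝ | 0 ≤ hyperdet (subTensor v i a b c p q r)} := by
    refine isClosed_le continuous_const (continuous_hyperdet.comp ?_)
    unfold subTensor
    fun_prop
  refine Projectivization.of_mk_mem_closure hclosed hs (fun v hv hv' => ?_) hT h
  obtain ⟨x, y, rfl⟩ := (mk_mem_real_secantPoints_iff (a := a) hn hv).1 hv'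
  rw [subTensor_eq_swapTensor _ _ hab hbc, hyperdet_swapTensor_add]
  positivity

theorem realRankTwoBoundary_subset_hyp (hn : ∀ j, 2 ≤ n j) :
    realRankTwoBoundary (segre n) ⊆ realPoints (hyp n) ∩ realRankTwoLocus (segre n) := by
  rintro x ⟨hx, hx'⟩
  refine ⟨?_, hx⟩
  induction x using Projectivization.ind with | h T hT => ?_
  rw [mk_mem_realPoints_hyp_iff]
  intro i a b c hab hbc p q r _ _ _
  by_contra hne
  have hpos := (hyperdet_subTensor_nonneg hT hn hx i hab hbc p q r).lt_of_ne' hne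
  rw [subTensor_eq_swapTensor _ _ hab hbc] at hpos
  exact hx' (mem_relativeInterior_of_hyperdet_pos hT hn (realRankTwoLocus_subset (a := a) hn hx)
    hpos)

end Real

/-! ### Tensors of format `2 × 2 × 2` with negative hyperdeterminant -/

/-- If the hyperdeterminant is a concave quadratic function, zero at `t = 0`, along a line through
`k`, then it is negative for small `t` of a suitable sign. -/
theorem mem_closure_hyperdet_neg_of_quadratic {k N : Fin 2 → Fin 2 → Fin 2 → ℝ} {c q : ℝ}
    (hq : 0 < q) (h : ∀ t : ℝ, hyperdet (k + t • N) = t * c - t ^ 2 * q) :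
    k ∈ closure {k : Fin 2 → Fin 2 → Fin 2 → ℝ | hyperdet k < 0} := by
  obtain ⟨ε, hε, hc⟩ : ∃ ε : ℝ, ε ^ 2 = 1 ∧ ε * c ≤ 0 := by
    rcases le_total c 0 with hc | hc
    · exact ⟨1, by norm_num, by linarith⟩
    · exact ⟨-1, by norm_num, by linarith⟩
  have hlim : Tendsto (fun t : ℝ => k + (t * ε) • N) (𝓝[>] 0) (𝓝 k) := by
    have : Continuous fun t : ℝ => k + (t * ε) • N := by fun_prop
    have := this.tendsto 0
    simp only [zero_mul, zero_smul, add_zero] at this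
    exact this.mono_left nhdsWithin_le_nhds
  refine mem_closure_of_tendsto hlim ?_
  filter_upwards [self_mem_nhdsWithin] with t ht
  have ht : 0 < t := ht
  change hyperdet _ < 0
  rw [h, mul_pow, hε]
  nlinarith [mul_pos (pow_pos ht 2) hq]

/-- If the slice `s` is invertible, adding to the other slice a small multiple of the slice `s`,
rotated by a right angle, makes the hyperdeterminant negative. -/
theorem mem_closure_hyperdet_neg_of_slice {k : Fin 2 → Fin 2 → Fin 2 → ℝ} (hk : hyperdet k = 0)
    {s : Fin 2} (hs : k s 0 0 * k s 1 1 - k s 1 0 * k s 0 1 ≠ 0) :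
    k ∈ closure {k : Fin 2 → Fin 2 → Fin 2 → ℝ | hyperdet k < 0} := by
  let N : Fin 2 → Fin 2 → Fin 2 → ℝ :=
    fun s' t u => if s' = s then 0 else ![k s 1 u, -k s 0 u] t
  refine mem_closure_hyperdet_neg_of_quadratic (N := N)
    -- The coefficient of `t` is determined by the value at `t = 1`.
    (c := hyperdet (k + N) + 4 * (k s 0 0 * k s 1 1 - k s 1 0 * k s 0 1) ^ 2)
    (q := 4 * (k s 0 0 * k s 1 1 - k s 1 0 * k s 0 1) ^ 2) (by positivity) fun t => ?_
  fin_cases s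
  · simp [hyperdet, N] at hk ⊢
    linear_combination (1 - t) * hk
  · simp [hyperdet, N] at hk ⊢
    linear_combination (1 - t) * hk

/-- Every real zero of the hyperdeterminant is a limit of tensors on which it is negative. -/
theorem mem_closure_hyperdet_neg {k : Fin 2 → Fin 2 → Fin 2 → ℝ} (hk : hyperdet k = 0) :
    k ∈ closure {k : Fin 2 → Fin 2 → Fin 2 → ℝ | hyperdet k < 0} := by
  by_cases hdet : ∃ s, k s 0 0 * k s 1 1 - k s 1 0 * k s 0 1 ≠ 0
  · obtain ⟨s, hs⟩ := hdet
    exact mem_closure_hyperdet_neg_of_slice hk hs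
  push Not at hdet
  -- The pencil of `k` vanishes identically; it suffices to perturb `k` along a direction `N` such
  -- that the pencil becomes a multiple of a square and one of the slices becomes invertible.
  suffices h : ∃ (N : Fin 2 → Fin 2 → Fin 2 → ℝ) (s : Fin 2), ∀ x : ℝ, x ≠ 0 →
      hyperdet (k + x • N) = 0 ∧ (k + x • N) s 0 0 * (k + x • N) s 1 1
        - (k + x • N) s 1 0 * (k + x • N) s 0 1 ≠ 0 by
    obtain ⟨N, s, h⟩ := h
    have hlim : Tendsto (fun x : ℝ => k + x • N) (𝓝[≠] 0) (𝓝 k) := by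
      have : Continuous fun x : ℝ => k + x • N := by fun_prop
      have := this.tendsto 0
      simp only [zero_smul, add_zero] at this
      exact this.mono_left nhdsWithin_le_nhds
    rw [← closure_closure]
    refine mem_closure_of_tendsto hlim ?_
    filter_upwards [self_mem_nhdsWithin] with x hx
    exact mem_closure_hyperdet_neg_of_slice (h x hx).1 (h x hx).2
  by_cases h0 : k = 0
  · refine ⟨fun s t u => if s = 0 ∧ t = u then 1 else 0, 0, fun x hx => ?_⟩
    subst h0
    simp [hyperdet, hx]
  obtain ⟨s, t, u, hne⟩ : ∃ s t u, k s t u ≠ 0 := by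
    by_contra! h
    exact h0 (funext fun s => funext fun t => funext fun u => h s t u)
  have e0 := hdet 0
  have e1 := hdet 1
  have hβ : k 0 0 0 * k 1 1 1 + k 1 0 0 * k 0 1 1 - k 0 1 0 * k 1 0 1 - k 1 1 0 * k 0 0 1 = 0 := by
    have : (k 0 0 0 * k 1 1 1 + k 1 0 0 * k 0 1 1 - k 0 1 0 * k 1 0 1
        - k 1 1 0 * k 0 0 1) ^ 2 = 0 := by
      simp only [hyperdet] at hk
      linear_combination hk + 4 * (k 1 0 0 * k 1 1 1 - k 1 1 0 * k 1 0 1) * e0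
    exact pow_eq_zero_iff two_ne_zero |>.1 this
  let N : Fin 2 → Fin 2 → Fin 2 → ℝ :=
    fun s' t' u' => if t' ≠ t ∧ u' ≠ u then k s' t u else 0
  refine ⟨N, s, fun x hx => ⟨?_, ?_⟩⟩
  · -- `α`, `β`, `γ` are the coefficients of the pencil of `k`, and `σ` is the sign of the
    -- perturbed matrix entry in the determinant.
    have hdisc : ∀ σ α β γ A B : ℝ, α = 0 → β = 0 → γ = 0 →
        (β + σ * x * (2 * A * B)) ^ 2 - 4 * (α + σ * x * A ^ 2) * (γ + σ * x * B ^ 2) = 0 := by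
      rintro σ _ _ _ A B rfl rfl rfl
      ring
    fin_cases t <;> fin_cases u
    · rw [← hdisc 1 _ _ _ (k 0 0 0) (k 1 0 0) e0 hβ e1]
      simp [hyperdet, N]
      ring
    · rw [← hdisc (-1) _ _ _ (k 0 0 1) (k 1 0 1) e0 hβ e1]
      simp [hyperdet, N]
      ring
    · rw [← hdisc (-1) _ _ _ (k 0 1 0) (k 1 1 0) e0 hβ e1]
      simp [hyperdet, N]
      ring
    · rw [← hdisc 1 _ _ _ (k 0 1 1) (k 1 1 1) e0 hβ e1]
      simp [hyperdet, N]
      ring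
  · have hpos : x * k s t u ^ 2 ≠ 0 := mul_ne_zero hx (pow_ne_zero 2 hne)
    have e := hdet s
    intro h
    apply hpos
    fin_cases t <;> fin_cases u <;> simp [N] at h <;>
      simp only [Fin.zero_eta, Fin.mk_one] <;> first
      | linear_combination h - e
      | linear_combination e - h

/-! ### Three modes -/

/-- A tensor whose flattening in the mode `a` has rank at most two is interpolated by two of its
slices. If the rank is less than two, one slice spans the others and the second slice is
arbitrary. -/
theorem exists_slice_combination_ne {K : Type*} [Field K] {d : ℕ} {n : Fin d → ℕ}
    {T : MultiIndex n → K} {a : Fin d} (hT : FlatteningMinorsVanish T a) (hn : ∀ j, 2 ≤ n j) :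
    ∃ p : Fin 2 → Fin (n a), p 0 ≠ p 1 ∧ ∃ A : Fin 2 → Fin (n a) → K,
      (∀ s t, A s (p t) = if s = t then 1 else 0) ∧
      ∀ i l, T (update i a l) = A 0 l * T (update i a (p 0)) + A 1 l * T (update i a (p 1)) := by
  by_cases hm : ∃ (p : Fin 2 → Fin (n a)) (k k' : MultiIndex n),
      T (update k a (p 0)) * T (update k' a (p 1))
        - T (update k' a (p 0)) * T (update k a (p 1)) ≠ 0
  · obtain ⟨p, k, k', hm⟩ := hm
    refine ⟨p, fun h => hm ?_, exists_slice_combination hT hm⟩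
    rw [h]
    ring
  push Not at hm
  obtain ⟨l, k, hlk⟩ : ∃ (l : Fin (n a)) (k : MultiIndex n), T ≠ 0 → T (update k a l) ≠ 0 := by
    by_cases h0 : T = 0
    · exact ⟨⟨0, two_pos.trans_le (hn a)⟩, fun j => ⟨0, two_pos.trans_le (hn j)⟩,
        fun h => absurd h0 h⟩
    · obtain ⟨k, hk⟩ : ∃ k, T k ≠ 0 := by
        by_contra! h
        exact h0 (funext h)
      exact ⟨k a, k, fun _ => by rwa [Function.update_eq_self]⟩
  obtain ⟨m, hml⟩ : ∃ m : Fin (n a), m ≠ l := by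
    have : Nontrivial (Fin (n a)) := Fin.nontrivial_iff_two_le.2 (hn a)
    exact exists_ne l
  refine ⟨![l, m], hml.symm, ![fun x => if x = m then 0 else if x = l then 1 else
    T (update k a x) / T (update k a l), fun x => if x = m then 1 else 0], ?_, ?_⟩
  · intro s t
    fin_cases s <;> fin_cases t <;> simp [hml.symm]
  · intro i x
    by_cases hx : x = m
    · simp [hx]
    by_cases hx' : x = l
    · simp [hx', hml.symm]
    by_cases h0 : T = 0
    · simp [h0]
    have h := hm ![x, l] i k
    simp only [Matrix.cons_val_zero, Matrix.cons_val_one] at h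
    simp only [Matrix.cons_val_zero, Matrix.cons_val_one, if_neg hx, if_neg hx', zero_mul, add_zero]
    field_simp [hlk h0]
    linear_combination h

theorem exists_slice_combination_lt {K : Type*} [Field K] {d : ℕ} {n : Fin d → ℕ}
    {T : MultiIndex n → K} {a : Fin d} (hT : FlatteningMinorsVanish T a) (hn : ∀ j, 2 ≤ n j) :
    ∃ p : Fin 2 → Fin (n a), p 0 < p 1 ∧ ∃ A : Fin 2 → Fin (n a) → K,
      (∀ s t, A s (p t) = if s = t then 1 else 0) ∧
      ∀ i l, T (update i a l) = A 0 l * T (update i a (p 0)) + A 1 l * T (update i a (p 1)) := by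
  obtain ⟨p, hp, A, hA, h⟩ := exists_slice_combination_ne hT hn
  rcases hp.lt_or_gt with hlt | hlt
  · exact ⟨p, hlt, A, hA, h⟩
  · refine ⟨![p 1, p 0], hlt, ![A 1, A 0], ?_, fun i l => (h i l).trans (add_comm _ _)⟩
    intro s t
    fin_cases s <;> fin_cases t <;> simp [hA]

section ThreeModes

variable {n : Fin 3 → ℕ}

/-- The tensor with core `k` and factor matrices `A 0`, `A 1`, `A 2`. -/
def tucker {K : Type*} [Field K] (A : (j : Fin 3) → Fin 2 → Fin (n j) → K)
    (k : Fin 2 → Fin 2 → Fin 2 → K) : MultiIndex n → K :=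
  fun i => ∑ s, ∑ t, ∑ u, A 0 s (i 0) * A 1 t (i 1) * A 2 u (i 2) * k s t u

theorem tucker_rank_two {K : Type*} [Field K] (A : (j : Fin 3) → Fin 2 → Fin (n j) → K)
    {k : Fin 2 → Fin 2 → Fin 2 → K} {x y z x' y' z' : Fin 2 → K}
    (h : ∀ s t u, k s t u = x s * y t * z u + x' s * y' t * z' u) :
    tucker A k = rankOneTensor (fun j l => ∑ s, ![x, y, z] j s * A j s l)
      + rankOneTensor (fun j l => ∑ s, ![x', y', z'] j s * A j s l) := by
  funext i
  simp only [tucker, h, Pi.add_apply, rankOneTensor, Fin.prod_univ_three, Fin.sum_univ_two,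
    Matrix.cons_val_zero, Matrix.cons_val_one, Matrix.cons_val_two, Matrix.tail_cons,
    Matrix.head_cons]
  ring

theorem subTensor_tucker {K : Type*} [Field K] {A : (j : Fin 3) → Fin 2 → Fin (n j) → K}
    {p : (j : Fin 3) → Fin 2 → Fin (n j)} (hA : ∀ j s t, A j s (p j t) = if s = t then 1 else 0)
    (k : Fin 2 → Fin 2 → Fin 2 → K) (i : MultiIndex n) :
    subTensor (tucker A k) i 0 1 2 (p 0) (p 1) (p 2) = k := by
  funext s t u
  simp [subTensor, tucker, hA]

theorem eq_tucker_subTensor {K : Type*} [Field K] {T : MultiIndex n → K}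
    {A : (j : Fin 3) → Fin 2 → Fin (n j) → K} {p : (j : Fin 3) → Fin 2 → Fin (n j)}
    (h : ∀ j i l, T (update i j l) = A j 0 l * T (update i j (p j 0))
      + A j 1 l * T (update i j (p j 1))) (i₀ : MultiIndex n) :
    T = tucker A (subTensor T i₀ 0 1 2 (p 0) (p 1) (p 2)) := by
  funext i
  have hi : i = update (update (update i₀ 0 (i 0)) 1 (i 1)) 2 (i 2) := by
    funext j
    fin_cases j <;> simp
  have h10 : (1 : Fin 3) ≠ 0 := by decide
  have h20 : (2 : Fin 3) ≠ 0 := by decide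
  have h21 : (2 : Fin 3) ≠ 1 := by decide
  have h1 : ∀ f : MultiIndex n, ∀ x y z, T (update (update (update f 0 x) 1 y) 2 z) =
      A 1 0 y * T (update (update (update f 0 x) 1 (p 1 0)) 2 z)
        + A 1 1 y * T (update (update (update f 0 x) 1 (p 1 1)) 2 z) := by
    intro f x y z
    simp only [Function.update_comm h21.symm]
    exact h 1 _ y
  have h0 : ∀ f : MultiIndex n, ∀ x y z, T (update (update (update f 0 x) 1 y) 2 z) =
      A 0 0 x * T (update (update (update f 0 (p 0 0)) 1 y) 2 z)
        + A 0 1 x * T (update (update (update f 0 (p 0 1)) 1 y) 2 z) := by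
    intro f x y z
    simp only [Function.update_comm h10.symm, Function.update_comm h20.symm]
    exact h 0 _ x
  conv_lhs => rw [hi]
  rw [h 2, h1 _ _ _ (p 2 0), h1 _ _ _ (p 2 1)]
  rw [h0 _ _ (p 1 0) (p 2 0), h0 _ _ (p 1 1) (p 2 0), h0 _ _ (p 1 0) (p 2 1),
    h0 _ _ (p 1 1) (p 2 1)]
  simp only [tucker, Fin.sum_univ_two, subTensor]
  ring

theorem complexifyVec_tucker (A : (j : Fin 3) → Fin 2 → Fin (n j) → ℝ)
    (k : Fin 2 → Fin 2 → Fin 2 → ℝ) :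
    complexifyVec _ (tucker A k) =
      tucker (fun j s l => (A j s l : ℂ)) (fun s t u => (k s t u : ℂ)) := by
  funext i
  simp [complexifyVec_apply, tucker]

/-- A real tensor with three modes whose sub-hyperdeterminants vanish is a limit of real tensors of
complex rank two with a negative sub-hyperdeterminant; these lie on the secant variety but outside
the real rank two locus. -/
theorem notMem_relativeInterior_of_subHyperdetsVanish (hn : ∀ j, 2 ≤ n j)
    {T : MultiIndex n → ℝ} (hT : T ≠ 0)
    (h : Projectivization.mk ℝ T hT ∈ realPoints (secantVariety (segre n)))
    (hhyp : SubHyperdetsVanish T) :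
    Projectivization.mk ℝ T hT ∉ relativeInterior (segre n) := by
  choose p hp A hA hTA using fun j : Fin 3 =>
    exists_slice_combination_lt (secant_equations (a := j) hT hn h).1 hn
  let o : MultiIndex n := fun j => ⟨0, two_pos.trans_le (hn j)⟩
  have hcore := eq_tucker_subTensor hTA o
  have hzero := hhyp o 0 1 2 (by decide) (by decide) _ _ _ (hp 0) (hp 1) (hp 2)
  generalize subTensor T o 0 1 2 (p 0) (p 1) (p 2) = k at hcore hzero
  rintro ⟨⟨x, hx⟩, hint, hxT⟩
  change x = _ at hxT
  subst hxT
  obtain ⟨W, hW, hWopen, hTW⟩ := mem_interior.1 hint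
  obtain ⟨V, hV, rfl⟩ := isOpen_induced_iff.1 hWopen
  obtain ⟨O, hO, hOV⟩ := isOpen_induced_iff.1 (isOpen_coinduced.1 hV)
  have hcont : Continuous (tucker A) := by
    unfold tucker
    fun_prop
  have hmem : T ∈ O := by
    have : (⟨T, hT⟩ : {v : MultiIndex n → ℝ // v ≠ 0}) ∈ Subtype.val ⁻¹' O := by
      rw [hOV]
      exact hTW
    exact this
  have hnhds : tucker A ⁻¹' (O ∩ {0}ᶜ) ∈ 𝓝 k :=
    ((hO.inter isOpen_compl_singleton).preimage hcont).mem_nhds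
      (by rw [Set.mem_preimage, ← hcore]; exact ⟨hmem, hT⟩)
  obtain ⟨k', ⟨hk'O, hk'0⟩, hk'⟩ := mem_closure_iff_nhds.1 (mem_closure_hyperdet_neg hzero) _ hnhds
  have hk' : hyperdet k' < 0 := hk'
  have hne : tucker A k' ≠ 0 := hk'0
  have hV' : Projectivization.mk ℝ _ hne ∈ V := by
    have : (⟨_, hne⟩ : {v : MultiIndex n → ℝ // v ≠ 0}) ∈ Subtype.val ⁻¹' O := hk'O
    rw [hOV] at this
    exact this
  obtain ⟨δ, hδ⟩ := IsAlgClosed.exists_pow_nat_eq ((hyperdet k' : ℝ) : ℂ) two_pos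
  have hδ0 : δ ≠ 0 := by
    rintro rfl
    have : ((hyperdet k' : ℝ) : ℂ) = 0 := by rw [← hδ]; simp
    exact hk'.ne (Complex.ofReal_eq_zero.1 this)
  obtain ⟨x, y, z, x', y', z', hk2⟩ := exists_rank_two_of_hyperdet_eq_sq
    (fun s t u => (k' s t u : ℂ)) hδ0 (by rw [hyperdet_ofReal, hδ])
  have hsec := mk_mem_realPoints_secantVariety (a := 0) hn hne
    ((complexifyVec_tucker A k').trans (tucker_rank_two _ hk2))
  have hnonneg := hyperdet_subTensor_nonneg hne hn (@hW ⟨_, hsec⟩ hV') o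
    (a := 0) (b := 1) (c := 2) (by decide) (by decide) (p 0) (p 1) (p 2)
  rw [subTensor_tucker hA] at hnonneg
  exact hk'.not_ge hnonneg

end ThreeModes

/-! ### Four or more modes -/

section FourModes

variable {d : ℕ} {n : Fin d → ℕ}

/-- The two summands of the witness differ in each of the first four modes, so no product of their
cofactors survives in which both use the same index in one of these modes. -/
theorem prod_stdVec_mul_prod_eq_zero {i i' : MultiIndex n} {s : Finset (Fin d)} {j : Fin d}
    (hs : j ∈ s) (hj : (j : ℕ) < 4) (hi : i j = i' j) :
    (∏ j ∈ s, (stdVec 0 : Fin (n j) → ℝ) (i j)) *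
      ∏ j ∈ s, (if (j : ℕ) < 4 then stdVec 1 else stdVec 0 : Fin (n j) → ℝ) (i' j) = 0 := by
  by_cases h : (i j : ℕ) = 0
  · refine mul_eq_zero_of_right _ (Finset.prod_eq_zero hs ?_)
    rw [if_pos hj, stdVec, if_neg]
    rw [← hi, h]
    exact zero_ne_one
  · exact mul_eq_zero_of_left (Finset.prod_eq_zero hs (by rw [stdVec, if_neg h])) _

theorem exists_lt_four_ne (hd : 4 ≤ d) (a b c : Fin d) :
    ∃ j : Fin d, (j : ℕ) < 4 ∧ j ≠ a ∧ j ≠ b ∧ j ≠ c := by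
  by_contra! h
  have h0 := h ⟨0, by omega⟩ (by norm_num)
  have h1 := h ⟨1, by omega⟩ (by norm_num)
  have h2 := h ⟨2, by omega⟩ (by norm_num)
  have h3 := h ⟨3, by omega⟩ (by norm_num)
  simp only [ne_eq, Fin.ext_iff] at h0 h1 h2 h3
  omega

theorem subHyperdetsVanish_witnessTensor (hd : 4 ≤ d) : SubHyperdetsVanish (witnessTensor n) := by
  intro i a b c hab hbc p q r _ _ _
  obtain ⟨j, hj, hja, hjb, hjc⟩ := exists_lt_four_ne hd a b c
  have hs : j ∈ Finset.univ.erase a := Finset.mem_erase.2 ⟨hja, Finset.mem_univ j⟩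
  have key : ∀ k k' : MultiIndex n, k j = i j → k' j = i j →
      cofactor (fun _ => stdVec 0) a k
        * cofactor (fun j => if (j : ℕ) < 4 then stdVec 1 else stdVec 0) a k' = (0 : ℝ) :=
    fun k k' hk hk' => prod_stdVec_mul_prod_eq_zero hs hj (hk.trans hk'.symm)
  rw [subTensor_eq_swapTensor _ _ hab hbc, witnessTensor, hyperdet_swapTensor_add, pencilFactor,
    key _ _ (by simp [hjb, hjc]) (by simp [hjb, hjc]),
    key _ _ (by simp [hjb, hjc]) (by simp [hjb, hjc]),
    mul_comm (cofactor (fun j => if (j : ℕ) < 4 then stdVec 1 else stdVec 0) a _),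
    mul_comm (cofactor (fun j => if (j : ℕ) < 4 then stdVec 1 else stdVec 0) a _),
    key _ _ (by simp [hjb, hjc]) (by simp [hjb, hjc]),
    key _ _ (by simp [hjb, hjc]) (by simp [hjb, hjc])]
  simp

theorem witnessTensor_ne_zero (hd : 4 ≤ d) (hn : ∀ j, 2 ≤ n j) : witnessTensor n ≠ 0 := by
  intro h
  have h1 := congrFun h (fun j => ⟨0, two_pos.trans_le (hn j)⟩)
  have h0 : ∏ j : Fin d, (if (j : ℕ) < 4 then stdVec 1 else stdVec 0 : Fin (n j) → ℝ)
      ⟨0, two_pos.trans_le (hn j)⟩ = 0 :=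
    Finset.prod_eq_zero (Finset.mem_univ ⟨0, by omega⟩) (by simp [stdVec])
  simp only [witnessTensor, Pi.add_apply, rankOneTensor, h0] at h1
  simp [stdVec] at h1

/-- Grouping the third and fourth modes turns the witness into a tensor with three modes, which has
an array with pencil `x y` and hence with hyperdeterminant one. -/
theorem exists_hyperdet_swapTensor_witnessTensor (hd : 4 ≤ d) (hn : ∀ j, 2 ≤ n j) :
    ∃ (a : Fin d) (p : Fin 2 → Fin (n a)) (b : Fin d) (i i' : MultiIndex n),
      hyperdet (swapTensor (witnessTensor n) a p b i i') = 1 := by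
  let a : Fin d := ⟨0, by omega⟩
  let b : Fin d := ⟨1, by omega⟩
  let c : Fin d := ⟨2, by omega⟩
  let i : MultiIndex n := fun j => ⟨0, two_pos.trans_le (hn j)⟩
  let i' : MultiIndex n := fun j => ⟨if (j : ℕ) < 4 then 1 else 0, by have := hn j; split <;> omega⟩
  have hba : b ∈ Finset.univ.erase a := by simp [a, b]
  have hca : c ∈ Finset.univ.erase a := by simp [a, c]
  have hcb : c ≠ b := by simp [b, c]
  let p : Fin 2 → Fin (n a) := ![⟨0, two_pos.trans_le (hn a)⟩, ⟨1, hn a⟩]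
  refine ⟨a, p, b, i, i', ?_⟩
  have e1 : cofactor (fun _ => stdVec 0) a i = (1 : ℝ) :=
    Finset.prod_eq_one fun j _ => by simp [stdVec, i]
  have e2 : cofactor (fun j => if (j : ℕ) < 4 then stdVec 1 else stdVec 0) a i' = (1 : ℝ) :=
    Finset.prod_eq_one fun j _ => by by_cases h : (j : ℕ) < 4 <;> simp [stdVec, i', h]
  have e3 : cofactor (fun j => if (j : ℕ) < 4 then stdVec 1 else stdVec 0) a i = (0 : ℝ) :=
    Finset.prod_eq_zero hba (by simp [stdVec, i, b])
  have e4 : cofactor (fun _ => stdVec 0) a (update i b (i' b)) = (0 : ℝ) :=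
    Finset.prod_eq_zero hba (by simp [stdVec, i', b])
  have e5 : cofactor (fun _ => stdVec 0) a (update i' b (i b)) = (0 : ℝ) :=
    Finset.prod_eq_zero hca (by simp [stdVec, i', c, hcb, b])
  rw [witnessTensor, hyperdet_swapTensor_add, pencilFactor, e1, e2, e3, e4, e5]
  simp [p, stdVec, a]

theorem mk_witnessTensor_mem (hd : 4 ≤ d) (hn : ∀ j, 2 ≤ n j) (h : witnessTensor n ≠ 0) :
    Projectivization.mk ℝ (witnessTensor n) h ∈
      realPoints (hyp n) ∩ relativeInterior (segre n) := by
  refine ⟨(mk_mem_realPoints_hyp_iff h).2 (subHyperdetsVanish_witnessTensor hd), ?_⟩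
  obtain ⟨a, p, b, i, i', hdet⟩ := exists_hyperdet_swapTensor_witnessTensor hd hn
  refine mem_relativeInterior_of_hyperdet_pos h hn ?_ (hdet ▸ one_pos)
  exact realRankTwoLocus_subset (a := a) hn
    (subset_closure ((mk_mem_real_secantPoints_iff (a := a) hn h).2 ⟨_, _, rfl⟩))

end FourModes

theorem mainTheorem6 {d : ℕ} (hd : 3 ≤ d) (n : Fin d → ℕ) (hn : ∀ j, 2 ≤ n j) :
    realRankTwoBoundary (segre n) ⊆ realPoints (hyp n) ∩ realRankTwoLocus (segre n) ∧
    (d = 3 →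
      realRankTwoBoundary (segre n) = realPoints (hyp n) ∩ realRankTwoLocus (segre n)) ∧
    (4 ≤ d →
      realRankTwoBoundary (segre n) ⊂ realPoints (hyp n) ∩ realRankTwoLocus (segre n) ∧
      ∃ h : witnessTensor n ≠ 0,
        Projectivization.mk ℝ (witnessTensor n) h ∈
          realPoints (hyp n) ∩ relativeInterior (segre n)) := by
  refine ⟨realRankTwoBoundary_subset_hyp hn, ?_, fun hd => ?_⟩
  · rintro rfl
    refine (realRankTwoBoundary_subset_hyp hn).antisymm ?_
    rintro x ⟨hx, hx'⟩
    refine ⟨hx', ?_⟩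
    induction x using Projectivization.ind with | h T hT => ?_
    exact notMem_relativeInterior_of_subHyperdetsVanish hn hT
      (realRankTwoLocus_subset (a := 0) hn hx') ((mk_mem_realPoints_hyp_iff hT).1 hx)
  · have h := witnessTensor_ne_zero hd hn
    have hmem := mk_witnessTensor_mem hd hn h
    have hsub : relativeInterior (segre n) ⊆ realRankTwoLocus (segre n) := by
      rintro _ ⟨x, hx, rfl⟩
      have hx' := interior_subset hx
      exact hx'
    refine ⟨(realRankTwoBoundary_subset_hyp hn).ssubset_of_mem_notMem
      ⟨hmem.1, hsub hmem.2⟩ fun hb => hb.2 hmem.2, h, hmem⟩
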